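/- Let $|\cdot|$ be a norm on $\mathbb R^n$ with induced operator norm $\|\cdot\|$ on $\mathbb R^{n\times n}$, and let $\mu(A)=\lim_{s\searrow 0}\frac{\|I+sA\|-1}{s}$ be the corresponding matrix measure. Consider the system $\dot x=f(t,x)$, $t\ge t_0$, in $\mathbb R^n$, where $f$ is piecewise continuous in $t$ and continuously differentiable in $x$; that is, $f(t,\cdot)$ is $C^1$ for each $t\ge t_0$, and there is a set $D$ of times, finite on each bounded interval, such that $f$ and $\partial f/\partial x$ are continuous in $(t,x)$ for $t\in[t_0,\infty)\setminus D$ and have one-sided limits, locally uniformly in $x$, as $t$ tends to a point of $D$. Assume that the system is forward complete: for all $t_1\ge t_0$ and $x\in\mathbb R^n$ it has an (absolutely continuous) solution on $[t_1,\infty)$ with value $x$ at time $t_1$; this solution is unique, and $\xi(t,t_1,x)$ denotes its value at time $t\ge t_1$. Write $\xi(t_1,t_0,K)=\{\xi(t_1,t_0,x):x\in K\}$ for the reachable set at time $t_1$. Let $K\subset\mathbb R^n$ be compact with nonempty interior. For $\varepsilon>0$ and $T\ge 0$ let $S(f,t_0,\varepsilon,T,K)$ be the minimal cardinality of a set $F\subset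 K$ such that for every $\bar x\in K$ there is $x\in F$ with $|\xi(t,t_0,\bar x)-\xi(t,t_0,x)|<\varepsilon$ for all $t\in[t_0,t_0+T]$, and let $$h(f,t_0,K)=\lim_{\varepsilon\searrow 0}\limsup_{T\to\infty}\frac1T\log S(f,t_0,\varepsilon,T,K)$$ be the topological entropy. Then, with values in $[-\infty,\infty]$, $$h(f,t_0,K)\le n\max\{\hat\mu^*,0\},\qquad \hat\mu^*:=\inf_{t_1\ge t_0}\ \limsup_{t\to\infty}\ \max_{v\in\mathrm{co}(\xi(t_1,t_0,K))}\mu\!\left(\frac{\partial f}{\partial x}\big(t,\xi(t,t_1,v)\big)\right),$$ where $\mathrm{co}$ denotes the convex hull. -/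

import Mathlib

open Set Filter Topology

namespace TVEntropy

variable {E : Type*} [NormedAddCommGroup E] [NormedSpace ℝ E]

/-- Standing regularity of the right-hand side of `x' = f(t, x)`, `t ≥ t₀`: `f` is piecewise
continuous in `t` and continuously differentiable in `x`.  There is a set `D` of exceptional times,
finite on every bounded interval, such that `f` and its Jacobian `∂f/∂x` are continuous in `(t, x)`
for `t ∉ D`, and both have one-sided limits (locally uniformly in `x`) as `t` approaches a point
of `D`. -/
structure IsPiecewiseC1 (f : ℝ → E → E) (t₀ : ℝ) : Prop where
  contDiff : ∀ t, t₀ ≤ t → ContDiff ℝ 1 (f t)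
  piecewise : ∃ D : Set ℝ, (∀ b : ℝ, (D ∩ Icc t₀ b).Finite) ∧
    ContinuousOn (fun p : ℝ × E => f p.1 p.2) ((Ici t₀ \ D) ×ˢ univ) ∧
    ContinuousOn (fun p : ℝ × E => fderiv ℝ (f p.1) p.2) ((Ici t₀ \ D) ×ˢ univ) ∧
    (∀ τ ∈ D, t₀ ≤ τ → ∀ x : E,
      (∃ l, Tendsto (fun p : ℝ × E => f p.1 p.2) (𝓝[>] τ ×ˢ 𝓝 x) (𝓝 l)) ∧
      (∃ L, Tendsto (fun p : ℝ × E => fderiv ℝ (f p.1) p.2) (𝓝[>] τ ×ˢ 𝓝 x) (𝓝 L))) ∧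
    (∀ τ ∈ D, t₀ < τ → ∀ x : E,
      (∃ l, Tendsto (fun p : ℝ × E => f p.1 p.2) (𝓝[<] τ ×ˢ 𝓝 x) (𝓝 l)) ∧
      (∃ L, Tendsto (fun p : ℝ × E => fderiv ℝ (f p.1) p.2) (𝓝[<] τ ×ˢ 𝓝 x) (𝓝 L)))

/-- `γ` is a solution on `[t₁, ∞)` of `x' = f(t, x)` with `γ t₁ = x`, in integral form (that is,
`γ` is locally absolutely continuous and satisfies the differential equation almost everywhere). -/
structure IsSolution (f : ℝ → E → E) (t₁ : ℝ) (x : E) (γ : ℝ → E) : Prop where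
  continuousOn : ContinuousOn γ (Ici t₁)
  intervalIntegrable : ∀ t, t₁ ≤ t →
    IntervalIntegrable (fun s => f s (γ s)) MeasureTheory.volume t₁ t
  eq_integral : ∀ t, t₁ ≤ t → γ t = x + ∫ s in t₁..t, f s (γ s)

/-- Forward completeness: from every initial time `t₁ ≥ t₀` and every initial state there is a
solution on all of `[t₁, ∞)`. -/
def ForwardComplete (f : ℝ → E → E) (t₀ : ℝ) : Prop :=
  ∀ t₁, t₀ ≤ t₁ → ∀ x : E, ∃ γ : ℝ → E, IsSolution f t₁ x γ

open Classical in
/-- `sol f t t₁ x` is the value at time `t ≥ t₁` of the solution `ξ(t, t₁, x)` with initial state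
`x` at time `t₁` (which is unique under the standing regularity); the value is meaningless
if there is no global forward solution. -/
noncomputable def sol (f : ℝ → E → E) (t t₁ : ℝ) (x : E) : E :=
  if h : ∃ γ : ℝ → E, IsSolution f t₁ x γ then h.choose t else x

/-- The ball `B_{f,t₀}(x, ε, T)` of initial states whose trajectories stay `ε`-close to that of `x`
on `[t₀, t₀ + T]`. -/
def dynBall (f : ℝ → E → E) (t₀ : ℝ) (x : E) (ε T : ℝ) : Set E :=
  {y | ∀ t ∈ Icc t₀ (t₀ + T), ‖sol f t t₀ y - sol f t t₀ x‖ < ε}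

/-- `F ⊆ K` is `(T, ε)`-spanning for the initial set `K` at initial time `t₀`. -/
def IsSpanning (f : ℝ → E → E) (t₀ ε T : ℝ) (K F : Set E) : Prop :=
  F ⊆ K ∧ K ⊆ ⋃ x ∈ F, dynBall f t₀ x ε T

/-- `S(f, t₀, ε, T, K)`: the minimal cardinality of a `(T, ε)`-spanning set. -/
noncomputable def spanCard (f : ℝ → E → E) (t₀ ε T : ℝ) (K : Set E) : ℕ∞ :=
  ⨅ (F : Set E) (_ : IsSpanning f t₀ ε T K F), F.encard

/-- The exponential growth rate `limsup_{T → ∞} (1 / T) log S(f, t₀, ε, T, K)`. -/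
noncomputable def spanRate (f : ℝ → E → E) (t₀ ε : ℝ) (K : Set E) : EReal :=
  limsup (fun T : ℝ => ENNReal.log (spanCard f t₀ ε T K : ENNReal) / (T : EReal)) atTop

/-- The topological entropy `h(f, t₀, K)`: the limit as `ε ↘ 0` of the growth rate.  The rate is
nonincreasing in `ε`, so that the limit is the supremum over `ε > 0`; see `tendsto_spanRate`. -/
noncomputable def entropy (f : ℝ → E → E) (t₀ : ℝ) (K : Set E) : EReal :=
  ⨆ (ε : ℝ) (_ : 0 < ε), spanRate f t₀ ε K

/-- The matrix measure (logarithmic norm) `μ(A) = lim_{t ↘ 0} (‖I + tA‖ - 1) / t` with respect to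
the operator norm; the limit exists, see `tendsto_matrixMeasure`. -/
noncomputable def matrixMeasure (A : E →L[ℝ] E) : ℝ :=
  limUnder (𝓝[>] (0 : ℝ))
    (fun t : ℝ => (‖ContinuousLinearMap.id ℝ E + t • A‖ - 1) / t)

/-- The constant
`μ̂* = inf_{t₁ ≥ t₀} limsup_{t → ∞} max_{v ∈ co(ξ(t₁, t₀, K))} μ(∂f/∂x(t, ξ(t, t₁, v)))`,
an extended real number. -/
noncomputable def muHatStar (f : ℝ → E → E) (t₀ : ℝ) (K : Set E) : EReal :=
  ⨅ (t₁ : ℝ) (_ : t₀ ≤ t₁), limsup (fun t : ℝ =>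
    ⨆ v ∈ convexHull ℝ ((fun x => sol f t₁ t₀ x) '' K),
      (matrixMeasure (fderiv ℝ (f t) (sol f t t₁ v)) : EReal)) atTop

theorem dynBall_mono (f : ℝ → E → E) (t₀ : ℝ) (x : E) (T : ℝ) {ε ε' : ℝ} (h : ε ≤ ε') :
    dynBall f t₀ x ε T ⊆ dynBall f t₀ x ε' T :=
  fun _ hy t ht => (hy t ht).trans_le h

theorem spanCard_antitone (f : ℝ → E → E) (t₀ T : ℝ) (K : Set E) :
    Antitone (fun ε => spanCard f t₀ ε T K) := by
  intro ε ε' h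
  refine le_iInf₂ fun F hF => iInf₂_le F ⟨hF.1, hF.2.trans ?_⟩
  exact iUnion₂_mono fun x _ => dynBall_mono f t₀ x T h

theorem spanRate_antitone (f : ℝ → E → E) (t₀ : ℝ) (K : Set E) :
    Antitone (fun ε => spanRate f t₀ ε K) := by
  intro ε ε' h
  refine limsup_le_limsup ?_
  filter_upwards [eventually_ge_atTop (0 : ℝ)] with T hT
  refine EReal.div_le_div_right_of_nonneg (by exact_mod_cast hT) ?_
  exact ENNReal.log_monotone (by exact_mod_cast spanCard_antitone f t₀ T K h)

/-- The entropy is the limit of the growth rates as `ε ↘ 0`. -/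
theorem tendsto_spanRate (f : ℝ → E → E) (t₀ : ℝ) (K : Set E) :
    Tendsto (fun ε => spanRate f t₀ ε K) (𝓝[>] 0) (𝓝 (entropy f t₀ K)) := by
  have h := (spanRate_antitone f t₀ K).tendsto_nhdsGT 0
  rwa [sSup_image] at h

/-- The limit that defines the matrix measure exists. -/
theorem tendsto_matrixMeasure [Nontrivial E] (A : E →L[ℝ] E) :
    Tendsto (fun t : ℝ => (‖ContinuousLinearMap.id ℝ E + t • A‖ - 1) / t) (𝓝[>] (0 : ℝ))
      (𝓝 (matrixMeasure A)) := by
  have h1 : ‖ContinuousLinearMap.id ℝ E‖ = 1 := ContinuousLinearMap.norm_id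
  have hmono : MonotoneOn
      (fun t : ℝ => (‖ContinuousLinearMap.id ℝ E + t • A‖ - 1) / t) (Ioi 0) := by
    intro s hs t ht hst
    have hs' : (0 : ℝ) < s := hs
    have ht' : (0 : ℝ) < t := ht
    have key : ContinuousLinearMap.id ℝ E + s • A
        = (1 - s / t) • ContinuousLinearMap.id ℝ E
          + (s / t) • (ContinuousLinearMap.id ℝ E + t • A) := by
      rw [smul_add, smul_smul, div_mul_cancel₀ _ ht'.ne', sub_smul, one_smul]
      abel
    have hr : s / t ≤ 1 := (div_le_one ht').2 hst
    have hr0 : 0 ≤ s / t := by positivity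
    have hn : ‖ContinuousLinearMap.id ℝ E + s • A‖
        ≤ (1 - s / t) + (s / t) * ‖ContinuousLinearMap.id ℝ E + t • A‖ := by
      rw [key]
      refine (norm_add_le _ _).trans ?_
      rw [norm_smul, norm_smul, h1, Real.norm_of_nonneg (sub_nonneg.2 hr),
        Real.norm_of_nonneg hr0, mul_one]
    change (‖ContinuousLinearMap.id ℝ E + s • A‖ - 1) / s
      ≤ (‖ContinuousLinearMap.id ℝ E + t • A‖ - 1) / t
    rw [div_le_div_iff₀ hs' ht']
    have := mul_le_mul_of_nonneg_right hn ht'.le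
    have e : ((1 - s / t) + (s / t) * ‖ContinuousLinearMap.id ℝ E + t • A‖) * t
        = t - s + s * ‖ContinuousLinearMap.id ℝ E + t • A‖ := by
      field_simp
    rw [e] at this
    linarith
  have hbdd : BddBelow
      ((fun t : ℝ => (‖ContinuousLinearMap.id ℝ E + t • A‖ - 1) / t) '' Ioi 0) := by
    refine ⟨-‖A‖, ?_⟩
    rintro _ ⟨t, ht, rfl⟩
    have ht' : (0 : ℝ) < t := ht
    change -‖A‖ ≤ (‖ContinuousLinearMap.id ℝ E + t • A‖ - 1) / t
    rw [le_div_iff₀ ht']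
    have := norm_sub_le (ContinuousLinearMap.id ℝ E + t • A) (t • A)
    rw [add_sub_cancel_right, h1, norm_smul, Real.norm_of_nonneg ht'.le] at this
    linarith
  exact tendsto_nhds_limUnder ⟨_, hmono.tendsto_nhdsGT hbdd⟩

end TVEntropy

/-! Along a trajectory `γ`, the norm of the difference to a nearby trajectory grows at a rate of at
most `μ (∂f/∂x (t, γ t)) + η`, where `η` is the oscillation of the Jacobian near `γ`. Hence, if
`κ ≥ 0` eventually exceeds by a margin the matrix measure along all trajectories that start in
`co (ξ(t₁, t₀, K))` at time `t₁`, each of these trajectories is separated from the nearby ones at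
rate at most `κ`. How near they must be depends on the time horizon, but the constant of the
estimate does not, so integrating along segments of the convex hull and composing with the Lipschitz
map `ξ(t₁, t₀, ·)` gives `‖ξ(t, t₀, x) - ξ(t, t₀, y)‖ ≤ L e^{κ(t - t₀)} ‖x - y‖` on `K`. The centres
of a cover of `K` by balls of radius `δ e^{-κT}`, of which a volume comparison shows `O(e^{nκT})` to
suffice, are therefore spanning, so the entropy is at most `nκ`. -/

namespace TVEntropy

section Gronwall

/-- The lower right Dini derivative of `φ` at `t` is at most `m`. It is spelled out as the
condition on right slopes under which Mathlib states its comparison principles. -/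
def DiniDerivLE (φ : ℝ → ℝ) (t m : ℝ) : Prop :=
  ∀ r, m < r → ∃ᶠ s in 𝓝[>] t, (s - t)⁻¹ * (φ s - φ t) < r

variable {φ : ℝ → ℝ} {a b κ ρ t m m' : ℝ}

theorem DiniDerivLE.mono (h : DiniDerivLE φ t m) (hm : m ≤ m') : DiniDerivLE φ t m' :=
  fun r hr => h r (hm.trans_lt hr)

theorem diniDerivLE_of_eventually_slope_le {F : ℝ → ℝ} (hF : Tendsto F (𝓝[>] t) (𝓝 m))
    (h : ∀ᶠ s in 𝓝[>] t, (s - t)⁻¹ * (φ s - φ t) ≤ F s) : DiniDerivLE φ t m := by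
  intro r hr
  refine Eventually.frequently ?_
  filter_upwards [h, hF.eventually_lt_const hr] with s hs hsr using hs.trans_lt hsr

theorem le_mul_exp_of_diniDerivLE_Ioo (hab : a < b) (hφ : ContinuousOn φ (Icc a b))
    (h : ∀ t ∈ Ioo a b, DiniDerivLE φ t (κ * φ t)) : φ b ≤ φ a * Real.exp (κ * (b - a)) := by
  have hlim : Tendsto (fun t => φ t * Real.exp (κ * (b - t))) (𝓝[>] a)
      (𝓝 (φ a * Real.exp (κ * (b - a)))) := by
    have hφa : ContinuousWithinAt φ (Ioi a) a :=
      (hφ a (left_mem_Icc.2 hab.le)).mono_of_mem_nhdsWithin (Icc_mem_nhdsGT hab)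
    exact hφa.mul (by fun_prop)
  refine ge_of_tendsto hlim ?_
  filter_upwards [Ioo_mem_nhdsGT hab] with t ht
  have hgronwall := le_gronwallBound_of_liminf_deriv_right_le (δ := φ t) (K := κ) (ε := 0)
    (hφ.mono (Icc_subset_Icc_left ht.1.le)) (fun s hs => h s ⟨ht.1.trans_le hs.1, hs.2⟩) le_rfl
    (fun s _ => (add_zero _).ge) b (right_mem_Icc.2 ht.2.le)
  rwa [gronwallBound_ε0] at hgronwall

/-- The differential inequality is needed only below a threshold `ρ`, which the resulting bound
does not let `φ` reach; "eventually to the right" leaves room for a discrete set of exceptional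
times. -/
theorem le_mul_exp_of_eventually_diniDerivLE_of_lt (hφ : ContinuousOn φ (Icc a b)) (hκ : 0 ≤ κ)
    (h₀ : 0 ≤ φ a) (hρ : φ a * Real.exp (κ * (b - a)) < ρ)
    (h : ∀ t ∈ Ico a b, ∀ᶠ s in 𝓝[>] t, φ s < ρ → DiniDerivLE φ s (κ * φ s)) :
    ∀ t ∈ Icc a b, φ t ≤ φ a * Real.exp (κ * (t - a)) := by
  have hclosed : IsClosed ({t | φ t ≤ φ a * Real.exp (κ * (t - a))} ∩ Icc a b) := by
    rw [inter_comm]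
    exact isClosed_Icc.isClosed_le hφ (by fun_prop)
  refine hclosed.Icc_subset_of_forall_mem_nhdsGT_of_Icc_subset (by simp) fun t ht hle => ?_
  have hφt : φ t ≤ φ a * Real.exp (κ * (t - a)) := hle (right_mem_Icc.2 ht.1)
  have hlt : φ t < ρ := by
    refine lt_of_le_of_lt (hφt.trans ?_) hρ
    have := ht.2.le
    gcongr
  have hcont : ContinuousWithinAt φ (Ioi t) t :=
    (hφ t (Ico_subset_Icc_self ht)).mono_of_mem_nhdsWithin
      (mem_of_superset (Ioc_mem_nhdsGT ht.2) (Ioc_subset_Icc_self.trans (Icc_subset_Icc_left ht.1)))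
  obtain ⟨u, hu, hsub⟩ := mem_nhdsGT_iff_exists_Ioo_subset.1
    ((hcont.eventually_lt_const hlt).and ((h t ht).and (Ioc_mem_nhdsGT ht.2)))
  filter_upwards [Ioo_mem_nhdsGT hu] with s hs
  have hφs : φ s ≤ φ t * Real.exp (κ * (s - t)) := by
    refine le_mul_exp_of_diniDerivLE_Ioo hs.1 (hφ.mono (Icc_subset_Icc ht.1 (hsub hs).2.2.2)) ?_
    intro z hz
    obtain ⟨hzρ, hz', -⟩ := hsub ⟨hz.1, hz.2.trans hs.2⟩
    exact hz' hzρ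
  calc φ s ≤ φ t * Real.exp (κ * (s - t)) := hφs
    _ ≤ φ a * Real.exp (κ * (t - a)) * Real.exp (κ * (s - t)) := by gcongr
    _ = φ a * Real.exp (κ * (s - a)) := by rw [mul_assoc, ← Real.exp_add]; ring_nf

end Gronwall

section MatrixMeasure

variable {E : Type*} [NormedAddCommGroup E] [NormedSpace ℝ E]

theorem matrixMeasure_le_norm [Nontrivial E] (A : E →L[ℝ] E) : matrixMeasure A ≤ ‖A‖ := by
  refine le_of_tendsto (tendsto_matrixMeasure A) ?_
  filter_upwards [self_mem_nhdsWithin] with s (hs : 0 < s)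
  rw [div_le_iff₀ hs, sub_le_iff_le_add']
  calc ‖ContinuousLinearMap.id ℝ E + s • A‖ ≤ ‖ContinuousLinearMap.id ℝ E‖ + ‖s • A‖ :=
        norm_add_le _ _
    _ = 1 + ‖A‖ * s := by
        rw [ContinuousLinearMap.norm_id, norm_smul, Real.norm_of_nonneg hs.le, mul_comm]

theorem slope_norm_le (A : E →L[ℝ] E) (g : ℝ → E) {t s : ℝ} (hts : t < s) :
    (s - t)⁻¹ * (‖g s‖ - ‖g t‖) ≤
      (‖ContinuousLinearMap.id ℝ E + (s - t) • A‖ - 1) / (s - t) * ‖g t‖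
        + ‖slope g t s - A (g t)‖ := by
  have hpos : 0 < s - t := sub_pos.2 hts
  have hdecomp : g s = (ContinuousLinearMap.id ℝ E + (s - t) • A) (g t)
      + (s - t) • (slope g t s - A (g t)) := by
    rw [smul_sub, sub_smul_slope]
    simp
  have hnorm : ‖g s‖ ≤ ‖ContinuousLinearMap.id ℝ E + (s - t) • A‖ * ‖g t‖
      + (s - t) * ‖slope g t s - A (g t)‖ := by
    nth_rewrite 1 [hdecomp]
    refine (norm_add_le _ _).trans (add_le_add (ContinuousLinearMap.le_opNorm _ _) ?_)
    rw [norm_smul, Real.norm_of_nonneg hpos.le]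
  rw [inv_mul_le_iff₀ hpos, mul_add, ← mul_assoc, mul_div_cancel₀ _ hpos.ne']
  linarith

theorem diniDerivLE_norm_of_hasDerivWithinAt [Nontrivial E] {g : ℝ → E} {g' : E} {t : ℝ}
    (hg : HasDerivWithinAt g g' (Ioi t) t) (A : E →L[ℝ] E) :
    DiniDerivLE (fun s => ‖g s‖) t (matrixMeasure A * ‖g t‖ + ‖g' - A (g t)‖) := by
  have hsub : Tendsto (fun s => s - t) (𝓝[>] t) (𝓝[>] 0) := by
    simpa using (continuous_sub_right t).continuousWithinAt.tendsto_nhdsWithin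
      (s := Ioi t) (x := t) (t := Ioi 0) fun s hs => sub_pos.2 hs
  have hslope : Tendsto (slope g t) (𝓝[>] t) (𝓝 g') :=
    (hasDerivWithinAt_iff_tendsto_slope' self_notMem_Ioi).1 hg
  refine diniDerivLE_of_eventually_slope_le
    ((((tendsto_matrixMeasure A).comp hsub).mul_const ‖g t‖).add
      (hslope.sub_const (A (g t))).norm) ?_
  filter_upwards [self_mem_nhdsWithin] with s hs using slope_norm_le A g hs

end MatrixMeasure

section Lipschitz

variable {E F : Type*} [NormedAddCommGroup E] [NormedAddCommGroup F] {s : Set E} {L : NNReal}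
  {g : E → F}

theorem continuousOn_of_eventually_norm_sub_le
    (h : ∀ p ∈ s, ∀ᶠ q in 𝓝[s] p, ‖g q - g p‖ ≤ L * ‖q - p‖) : ContinuousOn g s := by
  intro p hp
  refine tendsto_iff_norm_sub_tendsto_zero.2
    (squeeze_zero' (Eventually.of_forall fun _ => norm_nonneg _) (h p hp) ?_)
  have hid : Tendsto (fun q : E => q) (𝓝[s] p) (𝓝 p) := tendsto_id.mono_left nhdsWithin_le_nhds
  simpa using (tendsto_iff_norm_sub_tendsto_zero.1 hid).const_mul (L : ℝ)

theorem lipschitzOnWith_of_eventually_norm_sub_le [NormedSpace ℝ E] (hs : Convex ℝ s)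
    (h : ∀ p ∈ s, ∀ᶠ q in 𝓝[s] p, ‖g q - g p‖ ≤ L * ‖q - p‖) :
    LipschitzOnWith L g s := by
  rw [lipschitzOnWith_iff_norm_sub_le]
  intro w hw v hv
  let p : ℝ → E := AffineMap.lineMap v w
  have hp : MapsTo p (Icc 0 1) s := fun τ hτ =>
    hs.segment_subset hv hw (segment_eq_image_lineMap ℝ v w ▸ mem_image_of_mem _ hτ)
  have hpsub (σ τ : ℝ) : ‖p σ - p τ‖ = |σ - τ| * ‖w - v‖ := by
    rw [← dist_eq_norm, dist_lineMap_lineMap, Real.dist_eq, dist_comm v w, dist_eq_norm]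
  have hpc : ContinuousOn p (Icc 0 1) := AffineMap.lineMap_continuous.continuousOn
  have hdini : ∀ τ ∈ Ico (0 : ℝ) 1,
      DiniDerivLE (fun σ => ‖g (p σ) - g v‖) τ (L * ‖w - v‖) := by
    intro τ hτ
    refine diniDerivLE_of_eventually_slope_le tendsto_const_nhds ?_
    have hpτ : Tendsto p (𝓝[>] τ) (𝓝[s] p τ) :=
      ((hpc τ (Ico_subset_Icc_self hτ)).tendsto_nhdsWithin hp).mono_left
        (nhdsWithin_le_of_mem (mem_of_superset (Ioc_mem_nhdsGT hτ.2)
          (Ioc_subset_Icc_self.trans (Icc_subset_Icc_left hτ.1))))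
    filter_upwards [hpτ.eventually (h _ (hp (Ico_subset_Icc_self hτ))), self_mem_nhdsWithin]
      with σ hσ (hτσ : τ < σ)
    rw [inv_mul_le_iff₀ (sub_pos.2 hτσ)]
    calc ‖g (p σ) - g v‖ - ‖g (p τ) - g v‖ ≤ ‖g (p σ) - g (p τ)‖ := by
          simpa using norm_sub_norm_le (g (p σ) - g v) (g (p τ) - g v)
      _ ≤ L * ‖p σ - p τ‖ := hσ
      _ = (σ - τ) * (L * ‖w - v‖) := by
          rw [hpsub, abs_of_pos (sub_pos.2 hτσ)]; ring
  have hbound := le_gronwallBound_of_liminf_deriv_right_le (δ := 0) (K := 0) (ε := L * ‖w - v‖)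
    (((continuousOn_of_eventually_norm_sub_le h).comp hpc hp).sub continuousOn_const).norm hdini
    (by simp [p]) (fun _ _ => by simp) 1 (by simp)
  simpa [gronwallBound_K0, p] using hbound

end Lipschitz

section ExceptionalSet

variable {E : Type*} [NormedAddCommGroup E] [NormedSpace ℝ E] {f : ℝ → E → E} {t₀ : ℝ} {D : Set ℝ}

/-- `D` is a set of exceptional times of the right-hand side `f` on `[t₀, ∞)`. This is the part of
`IsPiecewiseC1` that controls the solutions: at the exceptional times nothing is required of `f`
itself, only one-sided limits of its Jacobian. -/
structure IsExceptionalSet (f : ℝ → E → E) (t₀ : ℝ) (D : Set ℝ) : Prop where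
  finite : ∀ b : ℝ, (D ∩ Icc t₀ b).Finite
  differentiable : ∀ t ∈ Ici t₀ \ D, Differentiable ℝ (f t)
  continuousOn : ContinuousOn (fun p : ℝ × E => f p.1 p.2) ((Ici t₀ \ D) ×ˢ univ)
  continuousOn_fderiv :
    ContinuousOn (fun p : ℝ × E => fderiv ℝ (f p.1) p.2) ((Ici t₀ \ D) ×ˢ univ)
  tendsto_right : ∀ τ ∈ D, t₀ ≤ τ → ∀ x : E,
    ∃ L, Tendsto (fun p : ℝ × E => fderiv ℝ (f p.1) p.2) (𝓝[>] τ ×ˢ 𝓝 x) (𝓝 L)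
  tendsto_left : ∀ τ ∈ D, t₀ < τ → ∀ x : E,
    ∃ L, Tendsto (fun p : ℝ × E => fderiv ℝ (f p.1) p.2) (𝓝[<] τ ×ˢ 𝓝 x) (𝓝 L)

theorem IsPiecewiseC1.exists_isExceptionalSet (hf : IsPiecewiseC1 f t₀) :
    ∃ D, IsExceptionalSet f t₀ D := by
  obtain ⟨D, hfin, hcont, hcont', hright, hleft⟩ := hf.piecewise
  exact ⟨D, hfin, fun t ht => (hf.contDiff t ht.1).differentiable one_ne_zero, hcont, hcont',
    fun τ hτ h x => (hright τ hτ h x).2, fun τ hτ h x => (hleft τ hτ h x).2⟩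

namespace IsExceptionalSet

theorem eventually_notMem (hD : IsExceptionalSet f t₀ D) {t : ℝ} (ht : t₀ ≤ t) :
    ∀ᶠ s in 𝓝[>] t, s ∈ Ici t₀ \ D := by
  have hclosed : IsClosed ((D ∩ Icc t₀ (t + 1)) \ {t}) :=
    ((hD.finite (t + 1)).subset sdiff_subset).isClosed
  have hmem : ((D ∩ Icc t₀ (t + 1)) \ {t})ᶜ ∈ 𝓝 t := hclosed.isOpen_compl.mem_nhds (by simp)
  filter_upwards [nhdsWithin_le_nhds hmem, Ioo_mem_nhdsGT (lt_add_one t)] with s hs hst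
  exact ⟨ht.trans hst.1.le, fun hsD => hs ⟨⟨hsD, ht.trans hst.1.le, hst.2.le⟩, hst.1.ne'⟩⟩

theorem eventually_of_forall_tendsto_fderiv (hD : IsExceptionalSet f t₀ D) {ι : Type*}
    {l : Filter ι} {P : ι × ℝ × E → Prop} {t : ℝ} (ht : t₀ ≤ t) {x : E}
    (h : ∀ (k : Filter ℝ) (L : E →L[ℝ] E),
      Tendsto (fun p : ℝ × E => fderiv ℝ (f p.1) p.2) (k ×ˢ 𝓝 x) (𝓝 L) →
        ∀ᶠ q in l ×ˢ (k ×ˢ 𝓝 x), P q) :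
    ∀ᶠ q in l ×ˢ (𝓝[Ici t₀ \ D] t ×ˢ 𝓝 x), P q := by
  by_cases htD : t ∈ D
  · obtain ⟨L, hL⟩ := hD.tendsto_right t htD ht x
    have hne : ∀ s ∈ Ici t₀ \ D, s ≠ t := fun s hs hst => hs.2 (hst ▸ htD)
    rcases ht.eq_or_lt with rfl | hlt
    · have hle : 𝓝[Ici t₀ \ D] t₀ ≤ 𝓝[>] t₀ :=
        nhdsWithin_mono _ fun s hs => (mem_Ici.1 hs.1).lt_of_ne (hne s hs).symm
      exact (h _ L hL).filter_mono (prod_mono_right _ (prod_mono_left _ hle))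
    · obtain ⟨L', hL'⟩ := hD.tendsto_left t htD hlt x
      have hle : 𝓝[Ici t₀ \ D] t ≤ 𝓝[<] t ⊔ 𝓝[>] t := by
        rw [← nhdsWithin_union]
        exact nhdsWithin_mono _ fun s hs => lt_or_gt_of_ne (hne s hs)
      refine Eventually.filter_mono (prod_mono_right _ (prod_mono_left _ hle)) ?_
      rw [sup_prod, prod_sup, eventually_sup]
      exact ⟨h _ L' hL', h _ L hL⟩
  · refine h _ (fderiv ℝ (f t) x) ?_
    have hcont := hD.continuousOn_fderiv (t, x) ⟨⟨ht, htD⟩, mem_univ _⟩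
    rwa [ContinuousWithinAt, nhdsWithin_prod_eq, nhdsWithin_univ] at hcont

theorem eventually_forall_of_forall_tendsto_fderiv (hD : IsExceptionalSet f t₀ D) {ι : Type*}
    {l : Filter ι} {P : ι × ℝ × E → Prop} {a : ℝ} (ha : t₀ ≤ a) (b : ℝ) {Z : Set E}
    (hZ : IsCompact Z)
    (h : ∀ x ∈ Z, ∀ (k : Filter ℝ) (L : E →L[ℝ] E),
      Tendsto (fun p : ℝ × E => fderiv ℝ (f p.1) p.2) (k ×ˢ 𝓝 x) (𝓝 L) →
        ∀ᶠ q in l ×ˢ (k ×ˢ 𝓝 x), P q) :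
    ∀ᶠ i in l, ∀ t ∈ Icc a b \ D, ∀ x ∈ Z, P (i, t, x) := by
  have hlocal : ∀ p ∈ Icc a b ×ˢ Z,
      {q : ι × ℝ × E | q.2.1 ∈ Ici t₀ \ D → P q} ∈ l ×ˢ 𝓝 p := by
    rintro ⟨t, x⟩ ⟨ht, hx⟩
    obtain ⟨p, hp, q, hq, hpq⟩ :=
      eventually_prod_iff.1 (hD.eventually_of_forall_tendsto_fderiv (ha.trans ht.1) (h x hx))
    rw [← nhdsWithin_univ x, ← nhdsWithin_prod_eq, eventually_nhdsWithin_iff] at hq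
    exact eventually_prod_iff.2 ⟨p, hp, _, hq, fun hi _ hz hzD => hpq hi (hz ⟨hzD, mem_univ _⟩)⟩
  obtain ⟨U, hU, V, hV, hUV⟩ :=
    mem_prod_iff.1 ((isCompact_Icc.prod hZ).mem_prod_nhdsSet_of_forall hlocal)
  filter_upwards [hU] with i hi t ht x hx
  exact hUV (mk_mem_prod hi (subset_of_mem_nhdsSet hV (mk_mem_prod ht.1 hx)))
    ⟨ha.trans ht.1.1, ht.2⟩

theorem exists_norm_fderiv_le (hD : IsExceptionalSet f t₀ D) {a : ℝ} (ha : t₀ ≤ a) (b : ℝ)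
    {Z : Set E} (hZ : IsCompact Z) :
    ∃ M, ∀ t ∈ Icc a b \ D, ∀ x ∈ Z, ‖fderiv ℝ (f t) x‖ ≤ M := by
  refine (hD.eventually_forall_of_forall_tendsto_fderiv (l := atTop)
    (P := fun q : ℝ × ℝ × E => ‖fderiv ℝ (f q.2.1) q.2.2‖ ≤ q.1) ha b hZ
    fun x _ k L hL => ?_).exists
  have hbdd : ∀ᶠ p in k ×ˢ 𝓝 x, ‖fderiv ℝ (f p.1) p.2‖ < ‖L‖ + 1 :=
    hL.norm.eventually_lt_const (lt_add_one _)
  filter_upwards [(eventually_ge_atTop (‖L‖ + 1)).prod_mk hbdd] with q hq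
  exact hq.2.le.trans hq.1

theorem eventually_norm_fderiv_add_sub_le (hD : IsExceptionalSet f t₀ D) {a : ℝ} (ha : t₀ ≤ a)
    (b : ℝ) {Z : Set E} (hZ : IsCompact Z) {η : ℝ} (hη : 0 < η) :
    ∀ᶠ h in 𝓝 (0 : E), ∀ t ∈ Icc a b \ D, ∀ x ∈ Z,
      ‖fderiv ℝ (f t) (x + h) - fderiv ℝ (f t) x‖ ≤ η := by
  refine hD.eventually_forall_of_forall_tendsto_fderiv
    (P := fun q : E × ℝ × E => ‖fderiv ℝ (f q.2.1) (q.2.2 + q.1) - fderiv ℝ (f q.2.1) q.2.2‖ ≤ η)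
    ha b hZ fun x _ k L hL => ?_
  have htime : Tendsto (fun q : E × ℝ × E => q.2.1) (𝓝 0 ×ˢ (k ×ˢ 𝓝 x)) k :=
    tendsto_fst.comp tendsto_snd
  have hspace : Tendsto (fun q : E × ℝ × E => q.2.2 + q.1) (𝓝 0 ×ˢ (k ×ˢ 𝓝 x)) (𝓝 x) := by
    simpa using (tendsto_snd.comp tendsto_snd).add (tendsto_fst (f := 𝓝 (0 : E)))
  have hdiff := ((hL.comp (htime.prodMk hspace)).sub (hL.comp tendsto_snd)).norm
  rw [sub_self, norm_zero] at hdiff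
  exact (hdiff.eventually_lt_const hη).mono fun _ => le_of_lt

end IsExceptionalSet

end ExceptionalSet

section Solutions

variable {E : Type*} [NormedAddCommGroup E] [NormedSpace ℝ E] {f : ℝ → E → E} {t₀ a b t : ℝ}
  {D : Set ℝ} {x y : E} {γ γ' : ℝ → E}

namespace IsSolution

theorem apply_initial (h : IsSolution f a x γ) : γ a = x := by
  simpa using h.eq_integral a le_rfl

theorem restrict (h : IsSolution f a x γ) (hab : a ≤ b) : IsSolution f b (γ b) γ where
  continuousOn := h.continuousOn.mono (Ici_subset_Ici.2 hab)
  intervalIntegrable t ht :=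
    (h.intervalIntegrable b hab).symm.trans (h.intervalIntegrable t (hab.trans ht))
  eq_integral t ht := by
    rw [h.eq_integral t (hab.trans ht), h.eq_integral b hab, add_assoc,
      intervalIntegral.integral_add_adjacent_intervals (h.intervalIntegrable b hab)]
    exact (h.intervalIntegrable b hab).symm.trans (h.intervalIntegrable t (hab.trans ht))

theorem continuousWithinAt_rhs (h : IsSolution f a x γ) (hD : IsExceptionalSet f t₀ D)
    (ha : t₀ ≤ a) (hat : a ≤ t) (htD : t ∉ D) :
    ContinuousWithinAt (fun s => f s (γ s)) (Ioi t) t := by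
  have hγ : ContinuousWithinAt γ (Ioi t) t :=
    (h.continuousOn t hat).mono fun s hs => hat.trans (mem_Ioi.1 hs).le
  have hgraph : Tendsto (fun s => (s, γ s)) (𝓝[>] t) (𝓝[(Ici t₀ \ D) ×ˢ univ] (t, γ t)) := by
    refine tendsto_nhdsWithin_iff.2
      ⟨(tendsto_id.mono_left nhdsWithin_le_nhds).prodMk_nhds hγ, ?_⟩
    filter_upwards [hD.eventually_notMem (ha.trans hat)] with s hs using ⟨hs, mem_univ _⟩
  exact (hD.continuousOn (t, γ t) ⟨⟨ha.trans hat, htD⟩, mem_univ _⟩).tendsto.comp hgraph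

variable [CompleteSpace E]

theorem hasDerivWithinAt (h : IsSolution f a x γ) (hD : IsExceptionalSet f t₀ D)
    (ha : t₀ ≤ a) (hat : a ≤ t) (htD : t ∉ D) : HasDerivWithinAt γ (f t (γ t)) (Ioi t) t := by
  have hintegrable := (h.restrict hat).intervalIntegrable (t + 1) (by linarith)
  have hmeas : StronglyMeasurableAtFilter (fun s => f s (γ s)) (𝓝[>] t) :=
    ⟨Ioc t (t + 1), Ioc_mem_nhdsGT (lt_add_one t), hintegrable.aestronglyMeasurable⟩
  have hderiv := intervalIntegral.integral_hasDerivWithinAt_right (h.intervalIntegrable t hat)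
    (s := Ici t) hmeas (h.continuousWithinAt_rhs hD ha hat htD)
  refine ((hderiv.const_add x).mono Ioi_subset_Ici_self).congr_of_eventuallyEq ?_
    (h.eq_integral t hat)
  filter_upwards [self_mem_nhdsWithin] with s hs
  exact h.eq_integral s (hat.trans (mem_Ioi.1 hs).le)

variable [Nontrivial E]

theorem diniDerivLE_norm_sub (h : IsSolution f a x γ) (h' : IsSolution f a y γ')
    (hD : IsExceptionalSet f t₀ D) (ha : t₀ ≤ a) (hat : a ≤ t) (htD : t ∉ D) {ρ η : ℝ}
    (hosc : ∀ z ∈ Metric.ball (γ t) ρ, ‖fderiv ℝ (f t) z - fderiv ℝ (f t) (γ t)‖ ≤ η)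
    (hlt : ‖γ' t - γ t‖ < ρ) :
    DiniDerivLE (fun s => ‖γ' s - γ s‖) t
      ((matrixMeasure (fderiv ℝ (f t) (γ t)) + η) * ‖γ' t - γ t‖) := by
  have hderiv := (h'.hasDerivWithinAt hD ha hat htD).sub (h.hasDerivWithinAt hD ha hat htD)
  refine (diniDerivLE_norm_of_hasDerivWithinAt hderiv (fderiv ℝ (f t) (γ t))).mono ?_
  rw [add_mul]
  refine add_le_add le_rfl (Convex.norm_image_sub_le_of_norm_fderiv_le'
    (fun z _ => hD.differentiable t ⟨ha.trans hat, htD⟩ z) hosc (convex_ball _ _)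
    (Metric.mem_ball_self ((norm_nonneg _).trans_lt hlt)) (mem_ball_iff_norm.2 hlt))

theorem eventually_norm_sub_le (h : IsSolution f a x γ) (hD : IsExceptionalSet f t₀ D)
    (ha : t₀ ≤ a) {c κ : ℝ} (hκ : 0 ≤ κ) (hcκ : c < κ)
    (hμ : ∀ t ∈ Icc a b \ D, matrixMeasure (fderiv ℝ (f t) (γ t)) ≤ c) :
    ∀ᶠ y in 𝓝 x, ∀ γ', IsSolution f a y γ' →
      ∀ t ∈ Icc a b, ‖γ' t - γ t‖ ≤ ‖y - x‖ * Real.exp (κ * (t - a)) := by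
  have hZ : IsCompact (γ '' Icc a b) :=
    isCompact_Icc.image_of_continuousOn (h.continuousOn.mono Icc_subset_Ici_self)
  obtain ⟨ρ, hρ, hosc⟩ := Metric.eventually_nhds_iff_ball.1
    (hD.eventually_norm_fderiv_add_sub_le ha b hZ (sub_pos.2 hcκ))
  have hnear : ∀ᶠ y in 𝓝 x, ‖y - x‖ * Real.exp (κ * (b - a)) < ρ := by
    have hcont : Continuous fun y => ‖y - x‖ * Real.exp (κ * (b - a)) := by fun_prop
    exact hcont.continuousAt.eventually_lt_const (by simpa using hρ)
  filter_upwards [hnear] with y hy γ' h'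
  have hdini : ∀ t ∈ Icc a b \ D, ‖γ' t - γ t‖ < ρ →
      DiniDerivLE (fun s => ‖γ' s - γ s‖) t (κ * ‖γ' t - γ t‖) := by
    intro t ht hlt
    refine (h.diniDerivLE_norm_sub h' hD ha ht.1.1 ht.2 (η := κ - c) (fun z hz => ?_) hlt).mono ?_
    · simpa using hosc (z - γ t) (by simpa [dist_eq_norm] using hz) t ht _
        (mem_image_of_mem γ ht.1)
    · have := hμ t ht
      gcongr
      linarith
  have hgrowth := le_mul_exp_of_eventually_diniDerivLE_of_lt (φ := fun t => ‖γ' t - γ t‖)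
    (a := a) (b := b) (ρ := ρ) ((h'.continuousOn.sub h.continuousOn).norm.mono Icc_subset_Ici_self)
    hκ (norm_nonneg _) (by rwa [h.apply_initial, h'.apply_initial]) fun t ht => by
      filter_upwards [hD.eventually_notMem (ha.trans ht.1), Ioc_mem_nhdsGT ht.2] with s hs hsI
      exact hdini s ⟨⟨ht.1.trans hsI.1.le, hsI.2⟩, hs.2⟩
  simpa only [h.apply_initial, h'.apply_initial] using hgrowth

end IsSolution

theorem ForwardComplete.isSolution_sol (hfc : ForwardComplete f t₀) (ha : t₀ ≤ a) (x : E) :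
    IsSolution f a x (fun t => sol f t a x) := by
  have hex := hfc a ha x
  have hsol : (fun t => sol f t a x) = hex.choose := funext fun t => dif_pos hex
  exact hsol ▸ hex.choose_spec

variable [CompleteSpace E] [Nontrivial E]

theorem IsExceptionalSet.exists_eventually_norm_sub_le (hD : IsExceptionalSet f t₀ D)
    (ha : t₀ ≤ a) (b : ℝ) {Z : Set E} (hZ : IsCompact Z) :
    ∃ κ, 0 ≤ κ ∧ ∀ x γ, IsSolution f a x γ → MapsTo γ (Icc a b) Z →
      ∀ᶠ y in 𝓝 x, ∀ γ', IsSolution f a y γ' →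
        ∀ t ∈ Icc a b, ‖γ' t - γ t‖ ≤ ‖y - x‖ * Real.exp (κ * (t - a)) := by
  obtain ⟨M, hM⟩ := hD.exists_norm_fderiv_le ha b hZ
  refine ⟨max M 0 + 1, by positivity, fun x γ h hγ => ?_⟩
  refine h.eventually_norm_sub_le hD ha (c := max M 0) (by positivity) (lt_add_one _) fun t ht => ?_
  exact (matrixMeasure_le_norm _).trans ((hM t ht _ (hγ ht.1)).trans (le_max_left _ _))

theorem IsSolution.eqOn (h : IsSolution f a x γ) (h' : IsSolution f a x γ')
    (hD : IsExceptionalSet f t₀ D) (ha : t₀ ≤ a) : EqOn γ' γ (Ici a) := by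
  intro t ht
  have hZ : IsCompact (γ '' Icc a t) :=
    isCompact_Icc.image_of_continuousOn (h.continuousOn.mono Icc_subset_Ici_self)
  obtain ⟨κ, -, hκ⟩ := hD.exists_eventually_norm_sub_le ha t hZ
  have hle := (hκ x γ h (mapsTo_image _ _)).self_of_nhds γ' h' t (right_mem_Icc.2 ht)
  rwa [sub_self, norm_zero, zero_mul, norm_le_zero_iff, sub_eq_zero] at hle

theorem sol_sol (hD : IsExceptionalSet f t₀ D) (hfc : ForwardComplete f t₀) (ha : t₀ ≤ a)
    (hab : a ≤ b) (hbt : b ≤ t) (x : E) : sol f t b (sol f b a x) = sol f t a x :=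
  ((hfc.isSolution_sol ha x).restrict hab).eqOn (hfc.isSolution_sol (ha.trans hab) _) hD
    (ha.trans hab) hbt

end Solutions

section SeparationRate

variable {E : Type*} [NormedAddCommGroup E] [NormedSpace ℝ E] {f : ℝ → E → E}

/-- Trajectories that start in `C` at time `t₁` separate at most at the exponential rate `κ`. -/
def HasSeparationRate (f : ℝ → E → E) (t₁ κ : ℝ) (C : Set E) : Prop :=
  ∃ L : NNReal, ∀ t, t₁ ≤ t →
    LipschitzOnWith (L * (Real.exp (κ * (t - t₁))).toNNReal) (sol f t t₁) C

variable [FiniteDimensional ℝ E] [Nontrivial E] {t₀ a b c κ : ℝ} {D : Set ℝ} {C K : Set E}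

theorem isBounded_image2_sol (hD : IsExceptionalSet f t₀ D) (hfc : ForwardComplete f t₀)
    (ha : t₀ ≤ a) (b : ℝ) (hC : Bornology.IsBounded C) :
    Bornology.IsBounded (image2 (fun t x => sol f t a x) (Icc a b) C) := by
  obtain ⟨R, hR⟩ := hC.subset_closedBall 0
  refine Bornology.IsBounded.subset ?_ (image2_subset_left hR)
  refine (isCompact_closedBall (0 : E) R).induction_on
    (p := fun s => Bornology.IsBounded (image2 (fun t x => sol f t a x) (Icc a b) s))
    (by simp) (fun s s' hss' hs' => hs'.subset (image2_subset_left hss'))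
    (fun s s' hs hs' => image2_union_right ▸ hs.union hs') fun x _ => ?_
  have hx := hfc.isSolution_sol ha x
  have hZ : IsCompact ((fun t => sol f t a x) '' Icc a b) :=
    isCompact_Icc.image_of_continuousOn (hx.continuousOn.mono Icc_subset_Ici_self)
  obtain ⟨κ, hκ, hsep⟩ := hD.exists_eventually_norm_sub_le ha b hZ
  refine ⟨_, mem_nhdsWithin_of_mem_nhds (inter_mem (hsep x _ hx (mapsTo_image _ _))
    (Metric.ball_mem_nhds x one_pos)), (hZ.isBounded.cthickening
      (δ := Real.exp (κ * (b - a)))).subset ?_⟩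
  rintro _ ⟨t, ht, y, ⟨hy, hyx⟩, rfl⟩
  refine Metric.mem_cthickening_of_dist_le _ _ _ _ (mem_image_of_mem _ ht) ?_
  rw [Metric.mem_ball, dist_eq_norm] at hyx
  calc dist (sol f t a y) (sol f t a x) ≤ ‖y - x‖ * Real.exp (κ * (t - a)) := by
        simpa only [dist_eq_norm] using hy _ (hfc.isSolution_sol ha y) t ht
    _ ≤ 1 * Real.exp (κ * (b - a)) := by
        have := ht.2
        gcongr
    _ = Real.exp (κ * (b - a)) := one_mul _

theorem exists_lipschitzOnWith_sol (hD : IsExceptionalSet f t₀ D) (hfc : ForwardComplete f t₀)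
    (ha : t₀ ≤ a) (b : ℝ) (hC : Bornology.IsBounded C) :
    ∃ L : NNReal, ∀ t ∈ Icc a b, LipschitzOnWith L (sol f t a) C := by
  obtain ⟨R, hR⟩ := hC.subset_closedBall 0
  have hZ := (isBounded_image2_sol hD hfc ha b
    (Metric.isBounded_closedBall (x := (0 : E)) (r := R))).isCompact_closure
  obtain ⟨κ, hκ, hsep⟩ := hD.exists_eventually_norm_sub_le ha b hZ
  refine ⟨(Real.exp (κ * (b - a))).toNNReal, fun t ht => LipschitzOnWith.mono ?_ hR⟩
  refine lipschitzOnWith_of_eventually_norm_sub_le (convex_closedBall 0 R) fun x hx => ?_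
  refine ((hsep x _ (hfc.isSolution_sol ha x) fun s hs =>
    subset_closure (mem_image2_of_mem hs hx)).filter_mono nhdsWithin_le_nhds).mono fun y hy => ?_
  rw [Real.coe_toNNReal _ (Real.exp_pos _).le, mul_comm]
  refine (hy _ (hfc.isSolution_sol ha y) t ht).trans ?_
  have := ht.2
  gcongr

theorem hasSeparationRate_of_forall_ge (hD : IsExceptionalSet f t₀ D)
    (hfc : ForwardComplete f t₀) (ha : t₀ ≤ a) (hab : a ≤ b) (hC : Bornology.IsBounded C)
    (hκ : 0 ≤ κ) {L : NNReal}
    (h : ∀ t, b ≤ t → LipschitzOnWith (L * (Real.exp (κ * (t - b))).toNNReal) (sol f t a) C) :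
    HasSeparationRate f a κ C := by
  obtain ⟨L₀, hL₀⟩ := exists_lipschitzOnWith_sol hD hfc ha b hC
  refine ⟨max L₀ L, fun t ht => ?_⟩
  rcases le_total t b with htb | hbt
  · have hexp : 1 ≤ (Real.exp (κ * (t - a))).toNNReal :=
      Real.one_le_toNNReal.2 (Real.one_le_exp (mul_nonneg hκ (sub_nonneg.2 ht)))
    exact (hL₀ t ⟨ht, htb⟩).weaken
      ((le_max_left _ _).trans (le_mul_of_one_le_right zero_le hexp))
  · refine (h t hbt).weaken ?_
    gcongr
    exact le_max_right _ _

theorem HasSeparationRate.of_mapsTo_sol (hD : IsExceptionalSet f t₀ D) (hfc : ForwardComplete f t₀)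
    (ha : t₀ ≤ a) (hab : a ≤ b) (hK : Bornology.IsBounded K) (hκ : 0 ≤ κ)
    (hC : HasSeparationRate f b κ C) (hKC : MapsTo (sol f b a) K C) :
    HasSeparationRate f a κ K := by
  obtain ⟨L, hL⟩ := hC
  obtain ⟨L₀, hL₀⟩ := exists_lipschitzOnWith_sol hD hfc ha b hK
  refine hasSeparationRate_of_forall_ge hD hfc ha hab hK hκ (L := L * L₀) fun t ht => ?_
  have hcomp := (hL t ht).comp (hL₀ b ⟨hab, le_rfl⟩) hKC
  rw [mul_right_comm] at hcomp
  intro x hx y hy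
  simpa only [Function.comp_apply, sol_sol hD hfc ha hab ht] using hcomp hx hy

/-- The estimate of the matrix measure along a trajectory controls only the nearby ones; convexity
of `C` lets such local estimates be chained along segments. -/
theorem hasSeparationRate_of_convex (hD : IsExceptionalSet f t₀ D) (hfc : ForwardComplete f t₀)
    (ha : t₀ ≤ a) (hab : a ≤ b) (hC : Convex ℝ C) (hCb : Bornology.IsBounded C) (hκ : 0 ≤ κ)
    (hcκ : c < κ)
    (hμ : ∀ t, b ≤ t → ∀ v ∈ C, matrixMeasure (fderiv ℝ (f t) (sol f t a v)) ≤ c) :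
    HasSeparationRate f a κ C := by
  obtain ⟨L, hL⟩ := exists_lipschitzOnWith_sol hD hfc ha b hCb
  have hLb := hL b ⟨hab, le_rfl⟩
  refine hasSeparationRate_of_forall_ge hD hfc ha hab hCb hκ (L := L) fun t ht => ?_
  refine lipschitzOnWith_of_eventually_norm_sub_le hC fun v hv => ?_
  have hlocal := ((hfc.isSolution_sol ha v).restrict hab).eventually_norm_sub_le (b := t) hD
    (ha.trans hab) hκ hcκ fun s hs => hμ s hs.1.1 v hv
  filter_upwards [(hLb.continuousOn v hv).eventually hlocal, self_mem_nhdsWithin] with w hw hwC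
  calc ‖sol f t a w - sol f t a v‖
      ≤ ‖sol f b a w - sol f b a v‖ * Real.exp (κ * (t - b)) :=
        hw _ ((hfc.isSolution_sol ha w).restrict hab) t ⟨ht, le_rfl⟩
    _ ≤ L * ‖w - v‖ * Real.exp (κ * (t - b)) := by
        gcongr
        exact hLb.norm_sub_le hwC hv
    _ = ↑(L * (Real.exp (κ * (t - b))).toNNReal) * ‖w - v‖ := by
        rw [NNReal.coe_mul, Real.coe_toNNReal _ (Real.exp_pos _).le, mul_right_comm]

theorem hasSeparationRate_of_muHatStar_lt (hD : IsExceptionalSet f t₀ D)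
    (hfc : ForwardComplete f t₀) (hK : Bornology.IsBounded K) (hκ : 0 ≤ κ)
    (h : muHatStar f t₀ K < κ) : HasSeparationRate f t₀ κ K := by
  obtain ⟨c, hμc, hcκ⟩ := EReal.lt_iff_exists_real_btwn.1 h
  simp only [muHatStar, iInf_lt_iff] at hμc
  obtain ⟨t₁, ht₁, hlimsup⟩ := hμc
  obtain ⟨s, hs⟩ := eventually_atTop.1 (eventually_lt_of_limsup_lt hlimsup)
  have hmaps : MapsTo (sol f t₁ t₀) K (convexHull ℝ ((fun x => sol f t₁ t₀ x) '' K)) :=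
    fun x hx => subset_convexHull ℝ _ (mem_image_of_mem _ hx)
  have hbdd : Bornology.IsBounded ((fun x => sol f t₁ t₀ x) '' K) :=
    (isBounded_image2_sol hD hfc le_rfl t₁ hK).subset
      (image_subset_image2_right (f := fun t x => sol f t t₀ x) ⟨ht₁, le_rfl⟩)
  refine HasSeparationRate.of_mapsTo_sol hD hfc le_rfl ht₁ hK hκ ?_ hmaps
  refine hasSeparationRate_of_convex hD hfc ht₁ (le_max_left t₁ s) (convex_convexHull ℝ _)
    (isBounded_convexHull.2 hbdd) hκ (EReal.coe_lt_coe_iff.1 hcκ) fun t ht v hv => ?_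
  exact EReal.coe_le_coe_iff.1
    ((le_iSup₂_of_le v hv le_rfl).trans (hs t ((le_max_right _ _).trans ht)).le)

end SeparationRate

section Covering

open MeasureTheory Module Metric
open scoped ENNReal NNReal

variable {E : Type*} [NormedAddCommGroup E]

theorem packingNumber_mul_measure_ball_le [MeasurableSpace E] [BorelSpace E] (μ : Measure E)
    [μ.IsAddLeftInvariant] (r : ℝ≥0) (K : Set E) :
    (packingNumber r K : ℝ≥0∞) * μ (ball 0 (r / 2)) ≤ μ (thickening (r / 2) K) := by
  simp only [packingNumber, ENat.toENNReal_iSup, ENNReal.iSup_mul, iSup_le_iff]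
  intro S hSK hS
  have hball : ∀ x : E, μ (ball x (r / 2)) = μ (ball 0 (r / 2)) := fun x => by
    rw [← measure_preimage_add μ x (ball x (r / 2)), preimage_add_ball, sub_self]
  have hdisj : Pairwise (Function.onFun Disjoint fun x : S => ball (x : E) (r / 2)) := by
    intro x y hxy
    have hlt := hS x.2 y.2 (Subtype.coe_ne_coe.2 hxy)
    refine ball_disjoint_ball ?_
    rw [add_halves, dist_edist]
    exact ENNReal.toReal_mono (edist_ne_top _ _) hlt.le
  calc (S.encard : ℝ≥0∞) * μ (ball 0 (r / 2)) = ∑' x : S, μ (ball (x : E) (r / 2)) := by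
        simp only [hball, ENNReal.tsum_set_const]
    _ ≤ μ (⋃ x : S, ball (x : E) (r / 2)) :=
        tsum_meas_le_meas_iUnion_of_disjoint μ (fun _ => measurableSet_ball) hdisj
    _ ≤ μ (thickening (r / 2) K) := measure_mono <| iUnion_subset fun x =>
        ball_subset_thickening (hSK x.2) _

variable [NormedSpace ℝ E] [FiniteDimensional ℝ E]

theorem exists_coveringNumber_le {K : Set E} (hK : Bornology.IsBounded K) :
    ∃ A : ℝ, ∀ r : ℝ≥0, 0 < r → r ≤ 1 →
      (coveringNumber r K : ℝ≥0∞) ≤ ENNReal.ofReal (A * (r : ℝ)⁻¹ ^ finrank ℝ E) := by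
  borelize E
  let μ : Measure E := Measure.addHaar
  obtain ⟨R, hR, hKR⟩ := hK.subset_ball_lt 0 0
  refine ⟨(2 * (R + 1)) ^ finrank ℝ E, fun r hr hr1 => ?_⟩
  have hr2 : (0 : ℝ) < r / 2 := half_pos hr
  have hthick : thickening (r / 2 : ℝ) K ⊆ ball 0 (R + 1) := by
    refine (thickening_subset_of_subset _ hKR).trans ((Metric.thickening_ball _ _ _).trans
      (ball_subset_ball ?_))
    have : (r : ℝ) ≤ 1 := hr1
    linarith
  have hvol : (packingNumber r K : ℝ≥0∞) * ENNReal.ofReal ((r / 2) ^ finrank ℝ E) * μ (ball 0 1) ≤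
      ENNReal.ofReal ((R + 1) ^ finrank ℝ E) * μ (ball 0 1) := by
    rw [mul_assoc, ← μ.addHaar_ball_of_pos 0 hr2, ← μ.addHaar_ball_of_pos 0 (by positivity)]
    exact (packingNumber_mul_measure_ball_le μ r K).trans (measure_mono hthick)
  rw [ENNReal.mul_le_mul_iff_left (measure_ball_pos μ _ one_pos).ne' measure_ball_lt_top.ne,
    ← ENNReal.le_div_iff_mul_le (by simp [hr]) (by simp),
    ← ENNReal.ofReal_div_of_pos (by positivity), ← div_pow] at hvol
  calc (coveringNumber r K : ℝ≥0∞) ≤ packingNumber r K := by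
        exact_mod_cast coveringNumber_le_packingNumber r K
    _ ≤ ENNReal.ofReal (((R + 1) / (r / 2)) ^ finrank ℝ E) := hvol
    _ = ENNReal.ofReal ((2 * (R + 1)) ^ finrank ℝ E * (r : ℝ)⁻¹ ^ finrank ℝ E) := by
        rw [← mul_pow]
        congr 2
        field_simp

end Covering

section Entropy

open scoped ENNReal NNReal

theorem limsup_log_div_le_of_le_mul_exp {N : ℝ → ℝ≥0∞} {A c : ℝ}
    (h : ∀ᶠ T in atTop, N T ≤ ENNReal.ofReal (A * Real.exp (c * T))) :
    limsup (fun T : ℝ => ENNReal.log (N T) / (T : EReal)) atTop ≤ (c : EReal) := by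
  have hle : ∀ᶠ T : ℝ in atTop,
      ENNReal.log (N T) / (T : EReal) ≤ ((Real.log (max A 1) / T + c : ℝ) : EReal) := by
    filter_upwards [h, eventually_gt_atTop 0] with T hN hT
    have hN' : N T ≤ ENNReal.ofReal (max A 1 * Real.exp (c * T)) :=
      hN.trans (ENNReal.ofReal_le_ofReal (by gcongr; exact le_max_left _ _))
    have hlog : ENNReal.log (N T) ≤ ((Real.log (max A 1) + c * T : ℝ) : EReal) := by
      refine (ENNReal.log_monotone hN').trans_eq ?_
      rw [ENNReal.log_ofReal_of_pos (by positivity), Real.log_mul (by positivity) (by positivity),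
        Real.log_exp]
    refine (EReal.div_le_div_right_of_nonneg (by exact_mod_cast hT.le) hlog).trans_eq ?_
    rw [← EReal.coe_div, add_div, mul_div_cancel_right₀ _ hT.ne']
  have hlim : Tendsto (fun T : ℝ => Real.log (max A 1) / T + c) atTop (𝓝 c) := by
    simpa using (tendsto_const_nhds.div_atTop tendsto_id).add_const c
  exact (limsup_le_limsup hle).trans_eq ((continuous_coe_real_ereal.tendsto c).comp hlim).limsup_eq

variable {E : Type*} [NormedAddCommGroup E] [NormedSpace ℝ E] {f : ℝ → E → E} {t₀ : ℝ} {K : Set E}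

theorem spanCard_le_coveringNumber {T ε : ℝ} {L r : ℝ≥0} (hLr : L * r < ε)
    (h : ∀ t ∈ Icc t₀ (t₀ + T), LipschitzOnWith L (sol f t t₀) K) :
    spanCard f t₀ ε T K ≤ Metric.coveringNumber r K := by
  refine le_iInf₂ fun F hFK => le_iInf fun hF => iInf₂_le F ⟨hFK, fun y hy => ?_⟩
  obtain ⟨x, hx, hyx⟩ := hF hy
  refine mem_iUnion₂.2 ⟨x, hx, fun t ht => ?_⟩
  have hyx' : ‖y - x‖ ≤ r := by
    rw [← dist_eq_norm]
    simpa using hyx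
  calc ‖sol f t t₀ y - sol f t t₀ x‖ ≤ L * ‖y - x‖ := (h t ht).norm_sub_le hy (hFK hx)
    _ ≤ L * r := by gcongr
    _ < ε := hLr

variable [FiniteDimensional ℝ E]

theorem HasSeparationRate.entropy_le {κ : ℝ} (h : HasSeparationRate f t₀ κ K)
    (hK : Bornology.IsBounded K) (hκ : 0 ≤ κ) :
    entropy f t₀ K ≤ ((Module.finrank ℝ E * κ : ℝ) : EReal) := by
  refine iSup₂_le fun ε hε => ?_
  obtain ⟨L, hL⟩ := h
  obtain ⟨A, hA⟩ := exists_coveringNumber_le hK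
  obtain ⟨δ, hδ, hδ1, hLδ⟩ : ∃ δ : ℝ≥0, 0 < δ ∧ δ ≤ 1 ∧ L * δ < ε := by
    have hcont : Continuous fun δ : ℝ≥0 => (L * δ : ℝ) := by fun_prop
    have hsmall : ∀ᶠ δ : ℝ≥0 in 𝓝[>] 0, (L * δ : ℝ) < ε :=
      (hcont.tendsto' 0 0 (by simp)).eventually_lt_const hε |>.filter_mono nhdsWithin_le_nhds
    obtain ⟨δ, hLδ, hδ⟩ := (hsmall.and (Ioc_mem_nhdsGT one_pos)).exists
    exact ⟨δ, hδ.1, hδ.2, hLδ⟩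
  refine limsup_log_div_le_of_le_mul_exp (A := A * (δ : ℝ)⁻¹ ^ Module.finrank ℝ E) ?_
  filter_upwards [eventually_ge_atTop 0] with T hT
  let r : ℝ≥0 := δ * (Real.exp (-(κ * T))).toNNReal
  have hr : (r : ℝ) = δ * Real.exp (-(κ * T)) := by
    rw [NNReal.coe_mul, Real.coe_toNNReal _ (Real.exp_pos _).le]
  have hr0 : 0 < r := mul_pos hδ (Real.toNNReal_pos.2 (Real.exp_pos _))
  have hr1 : r ≤ 1 := mul_le_one' hδ1
    (Real.toNNReal_le_one.2 (Real.exp_le_one_iff.2 (neg_nonpos.2 (mul_nonneg hκ hT))))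
  have hspan : spanCard f t₀ ε T K ≤ Metric.coveringNumber r K := by
    refine spanCard_le_coveringNumber (L := L * (Real.exp (κ * T)).toNNReal) ?_ fun t ht =>
      (hL t ht.1).weaken ?_
    · rw [hr, NNReal.coe_mul, Real.coe_toNNReal _ (Real.exp_pos _).le, mul_mul_mul_comm,
        ← Real.exp_add, add_neg_cancel, Real.exp_zero, mul_one]
      exact hLδ
    · gcongr
      linarith [ht.2]
  calc (spanCard f t₀ ε T K : ℝ≥0∞) ≤ Metric.coveringNumber r K := by exact_mod_cast hspan
    _ ≤ ENNReal.ofReal (A * (r : ℝ)⁻¹ ^ Module.finrank ℝ E) := hA r hr0 hr1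
    _ = ENNReal.ofReal (A * (δ : ℝ)⁻¹ ^ Module.finrank ℝ E *
          Real.exp (Module.finrank ℝ E * κ * T)) := by
        rw [hr, mul_inv, ← Real.exp_neg, neg_neg, mul_pow, ← Real.exp_nat_mul, mul_assoc, mul_assoc]

end Entropy

end TVEntropy

theorem proposition2_general {E : Type*} [NormedAddCommGroup E] [NormedSpace ℝ E]
    [FiniteDimensional ℝ E] (f : ℝ → E → E) (t₀ : ℝ) {D : Set ℝ}
    (hD : TVEntropy.IsExceptionalSet f t₀ D) (hfc : TVEntropy.ForwardComplete f t₀)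
    (K : Set E) (hK : Bornology.IsBounded K) :
    TVEntropy.entropy f t₀ K ≤
      (Module.finrank ℝ E : EReal) * max (TVEntropy.muHatStar f t₀ K) 0 := by
  rcases subsingleton_or_nontrivial E with hE | hE
  · have hrate : TVEntropy.HasSeparationRate f t₀ 0 K :=
      ⟨0, fun t _ x _ y _ => by simp [Subsingleton.elim x y]⟩
    simpa [Module.finrank_zero_of_subsingleton] using hrate.entropy_le hK le_rfl
  · have hn : (0 : EReal) < Module.finrank ℝ E := by exact_mod_cast Module.finrank_pos
    rw [← EReal.div_le_iff_le_mul hn (EReal.natCast_ne_top _)]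
    refine EReal.le_of_forall_lt_iff_le.1 fun κ hκ => ?_
    obtain ⟨hμκ, hκ0⟩ := max_lt_iff.1 hκ
    have hκ0' : 0 ≤ κ := by exact_mod_cast hκ0.le
    rw [EReal.div_le_iff_le_mul hn (EReal.natCast_ne_top _)]
    exact_mod_cast
      (TVEntropy.hasSeparationRate_of_muHatStar_lt hD hfc hK hκ0' hμκ).entropy_le hK hκ0'

theorem proposition2 {E : Type*} [NormedAddCommGroup E] [NormedSpace ℝ E] [FiniteDimensional ℝ E]
    (f : ℝ → E → E) (t₀ : ℝ) (hf : TVEntropy.IsPiecewiseC1 f t₀)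
    (hfc : TVEntropy.ForwardComplete f t₀)
    (K : Set E) (hK : IsCompact K) (hKint : (interior K).Nonempty) :
    TVEntropy.entropy f t₀ K ≤
      (Module.finrank ℝ E : EReal) * max (TVEntropy.muHatStar f t₀ K) 0 := by
  obtain ⟨D, hD⟩ := hf.exists_isExceptionalSet
  exact proposition2_general f t₀ hD hfc K hK.isBounded
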